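/- For $m\in\{1,2,\dots\}$ let $S^m$ be the unit sphere of $\mathbb{R}^{m+1}$, and let $S^\infty$ be the unit sphere of the real sequence space $\ell^2$. Let $m,M\in\{1,2,\dots,\infty\}$. A real kernel $K$ on a set $X$ is positive definite if $\sum_{\mu,\nu=1}^n c_\mu c_\nu K(p_\mu,p_\nu)\ge 0$ for all $n\ge 1$, all distinct points $p_1,\dots,p_n\in X$ and all real scalars $c_1,\dots,c_n$; it is strictly positive definite if moreover these sums are positive whenever the $c_\mu$ are not all zero. A function $f:[-1,1]^2\to\mathbb{R}$ is the isotropic part of a kernel $K$ on $S^m\times S^M$ if $K((x,z),(y,w))=f(x\cdot y,z\cdot w)$ for all $x,y\in S^m$ and $z,w\in S^M$. A continuous function $g:[0,\infty)^2\to\mathbb{R}$ is completely monotonic on $(0,\infty)^2$ if it is $C^\infty$ on $(0,\infty)^2$ and $$(-1)^{n_1+n_2}\frac{\partial^{n_1+n_2}g}{\partial u^{n_1}\partial v^{n_2}}(u,v)\ge 0,\qquad u,v>0,\quad n_1,n_2\in\{0,1,2,\dots\}.$$ **Proposition.** If $g$ is completely monotonic on $(0,\infty)^2$, then $$f(t,s):=g(\arccos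 t,\arccos s),\qquad t,s\in[-1,1],$$ is the isotropic part of a continuous positive definite kernel on $S^m\times S^M$. Further, if $g$ is not of the form $g(u,v)=a(u)+b(v)$ on $[0,\infty)^2$ with functions $a,b:[0,\infty)\to\mathbb{R}$ (in particular $g$ is nonconstant), then $f$ is the isotropic part of a continuous strictly positive definite kernel on $S^m\times S^M$. -/

import Mathlib

open scoped ContDiff

/-- The ambient real Hilbert space of the sphere `S^m`, `m = 0, 1, 2, …, ∞`: the Euclidean space
`ℝ^(m+1)` for finite `m`, and the real sequence space `ℓ²` for `m = ∞`. -/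
def Ambient : ℕ∞ → Type
  | some m => EuclideanSpace ℝ (Fin (m + 1))
  | none => lp (fun _ : ℕ => ℝ) 2

noncomputable instance instNormedAddCommGroupAmbient :
    (m : ℕ∞) → NormedAddCommGroup (Ambient m)
  | some m => inferInstanceAs (NormedAddCommGroup (EuclideanSpace ℝ (Fin (m + 1))))
  | none => inferInstanceAs (NormedAddCommGroup (lp (fun _ : ℕ => ℝ) 2))

noncomputable instance instInnerProductSpaceAmbient :
    (m : ℕ∞) → InnerProductSpace ℝ (Ambient m)
  | some m => inferInstanceAs (InnerProductSpace ℝ (EuclideanSpace ℝ (Fin (m + 1))))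
  | none => inferInstanceAs (InnerProductSpace ℝ (lp (fun _ : ℕ => ℝ) 2))

/-- The unit sphere `S^m`, `m = 0, 1, 2, …, ∞`. It carries the subspace topology, which is also the
topology of the geodesic distance. -/
abbrev USphere (m : ℕ∞) : Type := Metric.sphere (0 : Ambient m) 1

/-- A real kernel `K` on `X` is positive definite if all its quadratic forms over finitely many
distinct points are nonnegative. -/
def IsPosDefKernel {X : Type} (K : X → X → ℝ) : Prop :=
  ∀ n : ℕ, 1 ≤ n → ∀ x : Fin n → X, Function.Injective x → ∀ c : Fin n → ℝ,
    0 ≤ ∑ μ, ∑ ν, c μ * c ν * K (x μ) (x ν)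

/-- `f` (only its values on `[-1,1]²` matter) is the isotropic part of the kernel `K` on
`S^m × S^M`: `K((x,z),(y,w)) = f(x·y, z·w)`. -/
def IsIsotropicPart {m M : ℕ∞} (f : ℝ → ℝ → ℝ)
    (K : USphere m × USphere M → USphere m × USphere M → ℝ) : Prop :=
  ∀ (x y : USphere m) (z w : USphere M),
    K (x, z) (y, w) = f (inner ℝ (x : Ambient m) (y : Ambient m))
      (inner ℝ (z : Ambient M) (w : Ambient M))

/-- `f` is the isotropic part of a (continuous) positive definite kernel on `S^m × S^M`. -/
def IsPartOfPosDef (m M : ℕ∞) (f : ℝ → ℝ → ℝ) : Prop :=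
  ∃ K : USphere m × USphere M → USphere m × USphere M → ℝ,
    IsIsotropicPart f K ∧ Continuous (Function.uncurry K) ∧ IsPosDefKernel K

/-- A positive definite kernel `K` on `X` is strictly positive definite of order `n` if its quadratic
forms over `n` distinct points are positive unless all the scalars vanish. -/
def IsStrictlyPosDefOfOrder {X : Type} (n : ℕ) (K : X → X → ℝ) : Prop :=
  IsPosDefKernel K ∧ ∀ x : Fin n → X, Function.Injective x → ∀ c : Fin n → ℝ, c ≠ 0 →
    0 < ∑ μ, ∑ ν, c μ * c ν * K (x μ) (x ν)

/-- `f` is the isotropic part of a (continuous) kernel on `S^m × S^M` that is strictly positive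
definite, that is, strictly positive definite of every order. -/
def IsPartOfStrictlyPosDef (m M : ℕ∞) (f : ℝ → ℝ → ℝ) : Prop :=
  ∃ K : USphere m × USphere M → USphere m × USphere M → ℝ,
    IsIsotropicPart f K ∧ Continuous (Function.uncurry K) ∧
      ∀ n : ℕ, 1 ≤ n → IsStrictlyPosDefOfOrder n K

/-- The partial derivative `∂^(i+j) g / ∂u^i ∂v^j` at `(u, v)`. -/
noncomputable def mixedPartial (i j : ℕ) (g : ℝ × ℝ → ℝ) (u v : ℝ) : ℝ :=
  iteratedDeriv i (fun u' => iteratedDeriv j (fun v' => g (u', v')) v) u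

/-- A function `g` on `[0,∞)²` (its values elsewhere are irrelevant) is completely monotonic on
`(0,∞)²` if it is continuous on `[0,∞)²`, smooth on `(0,∞)²`, and
`(-1)^(i+j) ∂^(i+j) g / ∂u^i ∂v^j ≥ 0` on `(0,∞)²` for all `i, j ≥ 0`. -/
structure IsCompletelyMonotonic (g : ℝ × ℝ → ℝ) : Prop where
  continuousOn : ContinuousOn g (Set.Ici 0 ×ˢ Set.Ici 0)
  contDiffOn : ContDiffOn ℝ ∞ g (Set.Ioi 0 ×ˢ Set.Ioi 0)
  sign : ∀ (i j : ℕ) (u v : ℝ), 0 < u → 0 < v → 0 ≤ (-1) ^ (i + j) * mixedPartial i j g u v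

/-! Since `arccos t = π/2 - arcsin t`, a kernel matrix has entries `g (c - A i j, c - B i j)` with
`c = π/2` and `A`, `B` the entrywise arcsines of Gram matrices. These are positive semidefinite with
entries in `[-c, c]`. Complete monotonicity makes the Taylor expansion of `g (c - a, c - b)` in `a`,
`b` have nonnegative coefficients and, by Bernstein's argument, converge for `|a|, |b| < c`. The
Schur product theorem then gives positivity; the boundary `|a| = c` or `|b| = c` is a limit of
dilations.

For strictness, any single Taylor term may be subtracted without losing positivity
(`posSemidef_sub`). So if the form of `g` vanishes at `w`, the form of `A ^ m ∘ B ^ n` vanishes at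
`w` whenever its coefficient is positive. A zero coefficient with `m, n ≥ 1` forces `g (u, v) = a u
+ b v` (`exists_add_of_signedPartial_eq_zero`). Otherwise all these forms vanish, and high powers
isolate the diagonal, so `w = 0` (`eq_zero_of_sum_pow_eq_zero`). -/

open Finset Filter Topology

/-! ### Bernstein's theorem: Taylor series of absolutely monotonic functions -/

section TaylorRemainder

variable {p : ℕ → ℝ → ℝ} {c : ℝ}

/-- The `n`-th Taylor remainder at `0` of `p k`, where `p (k + 1)` is the derivative of `p k`. -/
noncomputable def taylorRem (p : ℕ → ℝ → ℝ) (n k : ℕ) (x : ℝ) : ℝ :=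
  p k x - ∑ i ∈ range n, p (k + i) 0 / (i.factorial : ℝ) * x ^ i

theorem taylorRem_zero (p : ℕ → ℝ → ℝ) (k : ℕ) (x : ℝ) : taylorRem p 0 k x = p k x := by
  simp [taylorRem]

theorem taylorRem_succ_apply_zero (p : ℕ → ℝ → ℝ) (n k : ℕ) : taylorRem p (n + 1) k 0 = 0 := by
  simp [taylorRem, sum_range_succ']

theorem hasDerivAt_taylorRem_succ (hp : ∀ k x, x < c → HasDerivAt (p k) (p (k + 1) x) x)
    (n k : ℕ) {x : ℝ} (hx : x < c) :
    HasDerivAt (taylorRem p (n + 1) k) (taylorRem p n (k + 1) x) x := by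
  have hs : HasDerivAt (fun x => ∑ i ∈ range (n + 1), p (k + i) 0 / (i.factorial : ℝ) * x ^ i)
      (∑ i ∈ range (n + 1), p (k + i) 0 / (i.factorial : ℝ) * (i * x ^ (i - 1))) x :=
    HasDerivAt.fun_sum fun i _ => (hasDerivAt_pow i x).const_mul _
  refine ((hp k x hx).sub hs).congr_deriv ?_
  rw [taylorRem, sum_range_succ']
  simp only [Nat.cast_zero, zero_mul, mul_zero, add_zero]
  congr 1
  refine sum_congr rfl fun i _ => ?_
  rw [show k + 1 + i = k + (i + 1) by ring, Nat.factorial_succ, Nat.add_sub_cancel]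
  push_cast
  field_simp

theorem monotoneOn_of_hasDerivAt_nonneg {f f' : ℝ → ℝ} {s : Set ℝ} (hs : Convex ℝ s)
    (hf : ∀ x ∈ s, HasDerivAt f (f' x) x) (h0 : ∀ x ∈ s, 0 ≤ f' x) : MonotoneOn f s :=
  monotoneOn_of_hasDerivWithinAt_nonneg hs (fun x hx => (hf x hx).continuousAt.continuousWithinAt)
    (fun x hx => (hf x (interior_subset hx)).hasDerivWithinAt)
    (fun x hx => h0 x (interior_subset hx))

theorem taylorRem_nonneg (hp : ∀ k x, x < c → HasDerivAt (p k) (p (k + 1) x) x)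
    (h0 : ∀ k x, x < c → 0 ≤ p k x) (n k : ℕ) {x : ℝ} (hx0 : 0 ≤ x) (hx : x < c) :
    0 ≤ taylorRem p n k x := by
  induction n generalizing k x with
  | zero => rw [taylorRem_zero]; exact h0 k x hx
  | succ n ih =>
    have hm : MonotoneOn (taylorRem p (n + 1) k) (Set.Icc 0 x) :=
      monotoneOn_of_hasDerivAt_nonneg (convex_Icc _ _)
        (fun y hy => hasDerivAt_taylorRem_succ hp n k (hy.2.trans_lt hx))
        (fun y hy => ih (k + 1) hy.1 (hy.2.trans_lt hx))
    have := hm ⟨le_rfl, hx0⟩ ⟨hx0, le_rfl⟩ hx0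
    rwa [taylorRem_succ_apply_zero] at this

/-- Bernstein's estimate: differentiating in `b` reduces order `n + 1` to order `n`. It yields
geometric decay of the remainder with no bound on the derivatives. -/
theorem taylorRem_mul_le (hp : ∀ k x, x < c → HasDerivAt (p k) (p (k + 1) x) x)
    (h0 : ∀ k x, x < c → 0 ≤ p k x) {r : ℝ} (hr0 : 0 ≤ r) (hr1 : r ≤ 1) (n k : ℕ) {b : ℝ}
    (hb0 : 0 ≤ b) (hb : b < c) :
    taylorRem p n k (r * b) ≤ r ^ n * taylorRem p n k b := by
  induction n generalizing k b with
  | zero =>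
    simp only [taylorRem_zero, pow_zero, one_mul]
    have hle : r * b ≤ b := mul_le_of_le_one_left hb0 hr1
    have hm : MonotoneOn (p k) (Set.Iio c) :=
      monotoneOn_of_hasDerivAt_nonneg (convex_Iio _) (fun y hy => hp k y hy)
        (fun y hy => h0 (k + 1) y hy)
    exact hm (hle.trans_lt hb) hb hle
  | succ n ih =>
    have hlt : ∀ y ∈ Set.Icc 0 b, r * y < c := fun y hy =>
      ((mul_le_of_le_one_left hy.1 hr1).trans hy.2).trans_lt hb
    have hm : MonotoneOn
        (fun y => r ^ (n + 1) * taylorRem p (n + 1) k y - taylorRem p (n + 1) k (r * y))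
        (Set.Icc 0 b) := by
      refine monotoneOn_of_hasDerivAt_nonneg
        (f' := fun y => r ^ (n + 1) * taylorRem p n (k + 1) y - taylorRem p n (k + 1) (r * y) * r)
        (convex_Icc _ _) (fun y hy => ?_) (fun y hy => ?_)
      · refine ((hasDerivAt_taylorRem_succ hp n k (hy.2.trans_lt hb)).const_mul _).sub ?_
        have hl : HasDerivAt (fun y => r * y) r y := by
          simpa using (hasDerivAt_id y).const_mul r
        exact (hasDerivAt_taylorRem_succ hp n k (hlt y hy)).comp y hl
      · have := mul_le_mul_of_nonneg_right (ih (k + 1) hy.1 (hy.2.trans_lt hb)) hr0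
        rw [pow_succ]
        linarith
    have := hm ⟨le_rfl, hb0⟩ ⟨hb0, le_rfl⟩ hb0
    simp only [taylorRem_succ_apply_zero, mul_zero, sub_zero] at this
    linarith

/-- For `n = 0` this is monotonicity of `p k`; integrating it repeatedly bounds the remainder left
of `0` by the first omitted term. -/
theorem abs_taylorRem_neg_le (hp : ∀ k x, x < c → HasDerivAt (p k) (p (k + 1) x) x)
    (h0 : ∀ k x, x < c → 0 ≤ p k x) (hc : 0 < c) (n k : ℕ) {y : ℝ} (hy : 0 ≤ y) :
    |taylorRem p n k (-y)| ≤ p (k + n) 0 / (n.factorial : ℝ) * y ^ n := by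
  induction n generalizing k y with
  | zero =>
    have hm : MonotoneOn (p k) (Set.Iio c) :=
      monotoneOn_of_hasDerivAt_nonneg (convex_Iio _) (fun y hy => hp k y hy)
        (fun y hy => h0 (k + 1) y hy)
    have hyc : -y < c := by linarith
    rw [taylorRem_zero, abs_of_nonneg (h0 k _ hyc)]
    simpa using hm hyc hc (by linarith : -y ≤ 0)
  | succ n ih =>
    set C := p (k + (n + 1)) 0 with hC
    have hd : ∀ z ∈ Set.Icc 0 y, HasDerivAt (fun z => C / ((n + 1).factorial : ℝ) * z ^ (n + 1))
        (C / (n.factorial : ℝ) * z ^ n) z := by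
      intro z _
      refine ((hasDerivAt_pow (n + 1) z).const_mul (C / ((n + 1).factorial : ℝ))).congr_deriv ?_
      rw [Nat.factorial_succ, Nat.add_sub_cancel]
      push_cast
      field_simp
    have hR : ∀ z ∈ Set.Icc 0 y, HasDerivAt (fun z => taylorRem p (n + 1) k (-z))
        (-taylorRem p n (k + 1) (-z)) z := by
      intro z hz
      have hzc : -z < c := by linarith [hz.1]
      exact ((hasDerivAt_taylorRem_succ hp n k hzc).comp z (hasDerivAt_neg z)).congr_deriv
        (mul_neg_one _)
    have hb : ∀ z ∈ Set.Icc 0 y, |taylorRem p n (k + 1) (-z)| ≤ C / (n.factorial : ℝ) * z ^ n := by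
      intro z hz
      have := ih (k + 1) hz.1
      rwa [show k + 1 + n = k + (n + 1) by ring] at this
    have h1 := monotoneOn_of_hasDerivAt_nonneg (convex_Icc 0 y)
      (fun z hz => (hd z hz).sub (hR z hz)) (fun z hz => by
        have := abs_le.1 (hb z hz); linarith [this.1])
    have h2 := monotoneOn_of_hasDerivAt_nonneg (convex_Icc 0 y)
      (fun z hz => (hd z hz).add (hR z hz)) (fun z hz => by
        have := abs_le.1 (hb z hz); linarith [this.2])
    have e1 := h1 ⟨le_rfl, hy⟩ ⟨hy, le_rfl⟩ hy
    have e2 := h2 ⟨le_rfl, hy⟩ ⟨hy, le_rfl⟩ hy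
    simp [taylorRem_succ_apply_zero] at e1 e2
    rw [abs_le]
    constructor <;> linarith

theorem hasSum_taylor_of_nonneg (hp : ∀ k x, x < c → HasDerivAt (p k) (p (k + 1) x) x)
    (h0 : ∀ k x, x < c → 0 ≤ p k x) {x : ℝ} (hx0 : 0 ≤ x) (hx : x < c) :
    HasSum (fun k => p k 0 / (k.factorial : ℝ) * x ^ k) (p 0 x) := by
  have hc : 0 < c := hx0.trans_lt hx
  rw [hasSum_iff_tendsto_nat_of_nonneg fun k => by have := h0 k 0 hc; positivity]
  -- Any point strictly between `x` and `c` serves; the ratio `x / b < 1` drives the decay.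
  set b := (x + c) / 2 with hb
  have hb0 : 0 < b := by rw [hb]; linarith
  have hbc : b < c := by rw [hb]; linarith
  have hr0 : 0 ≤ x / b := by positivity
  have hr1 : x / b < 1 := by rw [div_lt_one hb0]; rw [hb]; linarith
  have hxb : x / b * b = x := by field_simp
  have hle : ∀ n, taylorRem p n 0 x ≤ (x / b) ^ n * p 0 b := by
    intro n
    have h1 := taylorRem_mul_le hp h0 hr0 hr1.le n 0 hb0.le hbc
    rw [hxb] at h1
    refine h1.trans (mul_le_mul_of_nonneg_left ?_ (by positivity))
    rw [taylorRem, sub_le_self_iff]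
    exact sum_nonneg fun i _ => by have := h0 (0 + i) 0 hc; positivity
  have ht : Tendsto (fun n => taylorRem p n 0 x) atTop (𝓝 0) := by
    refine squeeze_zero (fun n => taylorRem_nonneg hp h0 n 0 hx0 hx) hle ?_
    simpa using (tendsto_pow_atTop_nhds_zero_of_lt_one hr0 hr1).mul_const (p 0 b)
  have := (tendsto_const_nhds (x := p 0 x)).sub ht
  simpa [taylorRem] using this

theorem hasSum_taylor (hp : ∀ k x, x < c → HasDerivAt (p k) (p (k + 1) x) x)
    (h0 : ∀ k x, x < c → 0 ≤ p k x) {x : ℝ} (hx : |x| < c) :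
    HasSum (fun k => p k 0 / (k.factorial : ℝ) * x ^ k) (p 0 x) := by
  rcases le_total 0 x with hx0 | hx0
  · exact hasSum_taylor_of_nonneg hp h0 hx0 ((le_abs_self x).trans_lt hx)
  have hc : 0 < c := (abs_nonneg x).trans_lt hx
  have hs := (hasSum_taylor_of_nonneg hp h0 (abs_nonneg x) hx).summable
  have habs : Summable (fun k => p k 0 / (k.factorial : ℝ) * x ^ k) := by
    refine Summable.of_norm (hs.congr fun k => ?_)
    have := h0 k 0 hc
    rw [Real.norm_eq_abs, abs_mul, abs_pow, abs_of_nonneg (div_nonneg this (Nat.cast_nonneg _))]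
  refine (habs.hasSum_iff_tendsto_nat).2 ?_
  -- The remainder at `x ≤ 0` is dominated by the general term of the convergent series at `|x|`.
  have ht : Tendsto (fun n => taylorRem p n 0 x) atTop (𝓝 0) := by
    refine squeeze_zero_norm (fun n => ?_) hs.tendsto_atTop_zero
    have := abs_taylorRem_neg_le hp h0 hc n 0 (neg_nonneg.2 hx0)
    rw [Real.norm_eq_abs, abs_of_nonpos hx0]
    simpa using this
  have := (tendsto_const_nhds (x := p 0 x)).sub ht
  simpa [taylorRem] using this

end TaylorRemainder

/-! ### Completely monotonic functions of one variable -/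

/-- `h 0` is completely monotonic on `(0, ∞)` and `h k` is `(-1) ^ k` times its `k`-th derivative. -/
def IsCMSeq (h : ℕ → ℝ → ℝ) : Prop :=
  ∀ k u, 0 < u → 0 ≤ h k u ∧ HasDerivAt (h k) (-h (k + 1) u) u

namespace IsCMSeq

variable {h : ℕ → ℝ → ℝ}

theorem antitoneOn (hh : IsCMSeq h) (k : ℕ) : AntitoneOn (h k) (Set.Ioi 0) :=
  antitoneOn_of_hasDerivWithinAt_nonpos (convex_Ioi 0)
    (fun x hx => (hh k x hx).2.continuousAt.continuousWithinAt)
    (fun x hx => (hh k x (interior_subset hx)).2.hasDerivWithinAt)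
    (fun x hx => neg_nonpos.2 (hh (k + 1) x (interior_subset hx)).1)

theorem hasSum (hh : IsCMSeq h) {c x : ℝ} (hx : |x| < c) :
    HasSum (fun k => h k c / (k.factorial : ℝ) * x ^ k) (h 0 (c - x)) := by
  have := hasSum_taylor (p := fun k x => h k (c - x)) (c := c)
    (fun k x hx => by
      exact ((hh k (c - x) (sub_pos.2 hx)).2.comp x ((hasDerivAt_id x).const_sub c)).congr_deriv
        (by simp))
    (fun k x hx => (hh k (c - x) (sub_pos.2 hx)).1) hx
  simpa using this

theorem eq_zero_of_le (hh : IsCMSeq h) {k : ℕ} {c u : ℝ} (hc : 0 < c) (h0 : h k c = 0)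
    (hu : c ≤ u) : h k u = 0 :=
  le_antisymm (h0 ▸ hh.antitoneOn k hc (hc.trans_le hu) hu) (hh k u (hc.trans_le hu)).1

/-- A nonnegative function that is affine with nonpositive slope on a half-line has slope zero, so a
vanishing derivative passes down to order one. -/
theorem one_eq_zero (hh : IsCMSeq h) {k : ℕ} {c : ℝ} (hc : 0 < c) (h0 : h (k + 1) c = 0) :
    h 1 c = 0 := by
  induction k with
  | zero => exact h0
  | succ k ih =>
    apply ih
    -- `h (k + 1)` is constant on `[c, ∞)`, so `h k` is affine there with slope `-h (k + 1) c`
    have hconst : ∀ u, c ≤ u → h (k + 1) u = h (k + 1) c := by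
      intro u hu
      refine constant_of_has_deriv_right_zero (a := c) (b := u)
        (fun x hx => (hh (k + 1) x (hc.trans_le hx.1)).2.continuousAt.continuousWithinAt)
        (fun x hx => ?_) u ⟨hu, le_rfl⟩
      have := (hh (k + 1) x (hc.trans_le hx.1)).2.hasDerivWithinAt (s := Set.Ici x)
      rwa [hh.eq_zero_of_le hc h0 hx.1, neg_zero] at this
    set L := h (k + 1) c with hL
    have hlin : ∀ u, c ≤ u → h k u + L * u = h k c + L * c := by
      intro u hu
      refine constant_of_has_deriv_right_zero (f := fun u => h k u + L * u) (a := c) (b := u)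
        (fun x hx => ?_) (fun x hx => ?_) u ⟨hu, le_rfl⟩
      · exact ((hh k x (hc.trans_le hx.1)).2.continuousAt.add
          (by fun_prop)).continuousWithinAt
      · have h1 := (hh k x (hc.trans_le hx.1)).2.add ((hasDerivAt_id x).const_mul L)
        rw [hconst x hx.1] at h1
        exact (h1.congr_deriv (by simp)).hasDerivWithinAt
    by_contra hne
    have hLpos : 0 < L := lt_of_le_of_ne (hh (k + 1) c hc).1 (Ne.symm hne)
    have hk := (hh k c hc).1
    -- At this point the affine function takes the value `-1`.
    have hu : c ≤ c + (h k c + 1) / L := by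
      have : 0 < (h k c + 1) / L := by positivity
      linarith
    have h1 := hlin _ hu
    have h2 := (hh k _ (hc.trans_le hu)).1
    rw [mul_add, mul_div_cancel₀ _ hLpos.ne'] at h1
    linarith

/-- All derivatives vanish on `[c, ∞)`. The Taylor series centred at a large `d` reaches every `w`
in `(0, d]`, which carries constancy to the left of `c`. -/
theorem apply_eq (hh : IsCMSeq h) {k : ℕ} {c : ℝ} (hc : 0 < c) (h0 : h (k + 1) c = 0)
    {u v : ℝ} (hu : 0 < u) (hv : 0 < v) : h 0 u = h 0 v := by
  suffices H : ∀ w, 0 < w → ∀ d, c ≤ d → w ≤ d → h 0 w = h 0 d by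
    rw [H u hu (max c (max u v)) (by simp) (by simp), ← H v hv (max c (max u v)) (by simp) (by simp)]
  intro w hw d hcd hwd
  have h1 : ∀ u, c ≤ u → h 1 u = 0 := fun u => hh.eq_zero_of_le hc (hh.one_eq_zero hc h0)
  have hd : 0 < d := hc.trans_le hcd
  have hz : ∀ j u, c ≤ u → h (j + 1) u = 0 := by
    intro j
    induction j with
    | zero => exact h1
    | succ j ih =>
      intro u hu
      have e1 := (hh (j + 1) u (hc.trans_le hu)).2.hasDerivWithinAt (s := Set.Ici u)
      have e2 : HasDerivWithinAt (h (j + 1)) 0 (Set.Ici u) u :=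
        (hasDerivWithinAt_const u (Set.Ici u) (0 : ℝ)).congr
          (fun y hy => ih y (hu.trans hy)) (ih u hu)
      have := (uniqueDiffWithinAt_Ici u).eq_deriv _ e1 e2
      linarith
  have hs := hh.hasSum (c := d) (x := d - w) (by rw [abs_of_nonneg] <;> linarith)
  rw [sub_sub_cancel] at hs
  have hs' := hasSum_single (f := fun k => h k d / (k.factorial : ℝ) * (d - w) ^ k) 0
    (fun j hj => by
      obtain ⟨i, rfl⟩ := Nat.exists_eq_succ_of_ne_zero hj
      simp [hz i d hcd])
  simpa using hs.unique hs'

end IsCMSeq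

/-! ### Entrywise functions of positive semidefinite matrices -/

namespace Matrix

variable {ι : Type*}

section Fintype

variable [Fintype ι]

theorem posSemidef_iff_sum_nonneg {M : Matrix ι ι ℝ} :
    M.PosSemidef ↔ M.IsHermitian ∧ ∀ c : ι → ℝ, 0 ≤ ∑ i, ∑ j, c i * c j * M i j := by
  rw [posSemidef_iff_dotProduct_mulVec]
  refine and_congr_right fun _ => forall_congr' fun c => ?_
  simp only [dotProduct, mulVec, mul_sum, Pi.star_apply, star_trivial]
  exact iff_of_eq (congrArg _ (sum_congr rfl fun i _ => sum_congr rfl fun j _ => by ring))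

theorem posSemidef_of_tendsto {α : Type*} {l : Filter α} [l.NeBot] {F : α → Matrix ι ι ℝ}
    {M : Matrix ι ι ℝ} (hF : ∀ᶠ a in l, (F a).PosSemidef)
    (hM : ∀ i j, Tendsto (fun a => F a i j) l (𝓝 (M i j))) : M.PosSemidef := by
  refine posSemidef_iff_sum_nonneg.2 ⟨IsHermitian.ext fun i j => ?_, fun c => ?_⟩
  · refine tendsto_nhds_unique ((hM j i).congr' ?_) (hM i j)
    filter_upwards [hF] with a ha using by simpa using ha.1.apply i j
  · refine ge_of_tendsto (tendsto_finsetSum _ fun i _ => tendsto_finsetSum _ fun j _ =>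
      (hM i j).const_mul (c i * c j)) ?_
    filter_upwards [hF] with a ha using (posSemidef_iff_sum_nonneg.1 ha).2 c

theorem posSemidef_of_hasSum {F : ℕ → Matrix ι ι ℝ} {M : Matrix ι ι ℝ}
    (hF : ∀ k, (F k).PosSemidef) (hM : ∀ i j, HasSum (fun k => F k i j) (M i j)) :
    M.PosSemidef :=
  posSemidef_of_tendsto (l := atTop) (F := fun s : Finset ℕ => ∑ k ∈ s, F k)
    (Eventually.of_forall fun s => posSemidef_sum s fun k _ => hF k)
    (fun i j => by simpa only [Matrix.sum_apply] using! (hM i j : Tendsto _ _ _))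

/-- The difference is the sum of the remaining terms. -/
theorem posSemidef_sub_of_hasSum {F : ℕ → Matrix ι ι ℝ} {M : Matrix ι ι ℝ}
    (hF : ∀ k, (F k).PosSemidef) (hM : ∀ i j, HasSum (fun k => F k i j) (M i j)) (n : ℕ) :
    (M - F n).PosSemidef := by
  refine posSemidef_of_hasSum (F := Function.update F n 0) (fun k => ?_) (fun i j => ?_)
  · rcases eq_or_ne k n with rfl | hk
    · simpa using PosSemidef.zero
    · simpa [hk] using hF k
  · have he : (fun k => Function.update F n 0 k i j) =
        Function.update (fun k => F k i j) n 0 := by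
      funext k
      rcases eq_or_ne k n with rfl | hk <;> simp [*]
    have hv : (M - F n) i j = 0 - F n i j + M i j := by
      rw [sub_apply]
      ring
    rw [he, hv]
    exact (hM i j).update n 0

end Fintype

theorem PosSemidef.of_mul {A B : Matrix ι ι ℝ} (hA : A.PosSemidef) (hB : B.PosSemidef) :
    (of fun i j => A i j * B i j).PosSemidef :=
  hA.hadamard hB

theorem PosSemidef.of_const_mul {A : Matrix ι ι ℝ} (hA : A.PosSemidef) {r : ℝ} (hr : 0 ≤ r) :
    (of fun i j => r * A i j).PosSemidef :=
  hA.smul hr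

variable [Finite ι]

theorem PosSemidef.of_pow {A : Matrix ι ι ℝ} (hA : A.PosSemidef) (k : ℕ) :
    (of fun i j => A i j ^ k).PosSemidef := by
  induction k with
  | zero =>
    convert posSemidef_vecMulVec_self_star (fun _ : ι => (1 : ℝ)) using 1
    ext i j
    simp [vecMulVec_apply]
  | succ k ih => simpa only [of_apply, pow_succ] using ih.of_mul hA

theorem PosSemidef.of_hasSum_pow {A : Matrix ι ι ℝ} (hA : A.PosSemidef) {a : ℕ → ℝ}
    (ha : ∀ k, 0 ≤ a k) {f : ℝ → ℝ} (hf : ∀ i j, HasSum (fun k => a k * A i j ^ k) (f (A i j))) :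
    (of fun i j => f (A i j)).PosSemidef := by
  cases nonempty_fintype ι
  exact posSemidef_of_hasSum (fun k => (hA.of_pow k).of_const_mul (ha k)) hf

theorem PosSemidef.of_exp {A : Matrix ι ι ℝ} (hA : A.PosSemidef) :
    (of fun i j => Real.exp (A i j)).PosSemidef := by
  refine hA.of_hasSum_pow (a := fun k => ((k.factorial : ℝ))⁻¹) (fun k => by positivity) ?_
  intro i j
  have := NormedSpace.expSeries_div_hasSum_exp (A i j)
  rw [← Real.exp_eq_exp_ℝ] at this
  simpa [div_eq_inv_mul] using this

theorem PosSemidef.of_neg_log_one_sub {A : Matrix ι ι ℝ} (hA : A.PosSemidef)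
    (h1 : ∀ i j, |A i j| < 1) : (of fun i j => -Real.log (1 - A i j)).PosSemidef := by
  cases nonempty_fintype ι
  refine posSemidef_of_hasSum (F := fun k => of fun i j => ((k : ℝ) + 1)⁻¹ * A i j ^ (k + 1))
    (fun k => (hA.of_pow (k + 1)).of_const_mul (by positivity)) fun i j => ?_
  simpa [div_eq_inv_mul] using Real.hasSum_pow_div_log_of_abs_lt_one (h1 i j)

/-- Writing the function as `exp (-log (1 - t²) / 2)` composes series with nonnegative coefficients.
-/
theorem PosSemidef.of_one_div_sqrt_one_sub_sq {A : Matrix ι ι ℝ} (hA : A.PosSemidef)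
    (h1 : ∀ i j, |A i j| < 1) : (of fun i j => 1 / √(1 - A i j ^ 2)).PosSemidef := by
  have h2 : ∀ i j, A i j ^ 2 < 1 := fun i j => (sq_lt_one_iff_abs_lt_one _).2 (h1 i j)
  convert (((hA.of_pow 2).of_neg_log_one_sub fun i j => ?_).of_const_mul
    (by norm_num : (0 : ℝ) ≤ 1 / 2)).of_exp using 1
  · ext i j
    have hp : 0 < 1 - A i j ^ 2 := sub_pos.2 (h2 i j)
    simp only [of_apply]
    rw [one_div_mul_eq_div, Real.exp_half, Real.exp_neg, Real.exp_log hp, Real.sqrt_inv, one_div]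
  · simpa using h2 i j

/-- Schur-type positivity of the arcsine: `d/dr arcsin (r t) = t / √(1 - (r t)²)` preserves
positive semidefiniteness entrywise. -/
theorem PosSemidef.of_arcsin {A : Matrix ι ι ℝ} (hA : A.PosSemidef) (h1 : ∀ i j, |A i j| ≤ 1) :
    (of fun i j => Real.arcsin (A i j)).PosSemidef := by
  cases nonempty_fintype ι
  refine posSemidef_iff_sum_nonneg.2 ⟨IsHermitian.ext fun i j => ?_, fun c => ?_⟩
  · have := hA.1.apply i j
    simp_all
  -- The form vanishes at `r = 0`. For `0 < r < 1` the entries `r * A i j` avoid `±1`, where arcsine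
  -- is not differentiable.
  have hm : MonotoneOn (fun r => ∑ i, ∑ j, c i * c j * Real.arcsin (r * A i j)) (Set.Icc 0 1) := by
    refine monotoneOn_of_hasDerivWithinAt_nonneg (f' := fun r =>
      ∑ i, ∑ j, c i * c j * (1 / √(1 - (r * A i j) ^ 2) * A i j)) (convex_Icc _ _)
      (Continuous.continuousOn (by fun_prop)) (fun r hr => ?_) (fun r hr => ?_)
    all_goals
      rw [interior_Icc] at hr
      have hlt : ∀ i j, |r * A i j| < 1 := fun i j => by
        rw [abs_mul, abs_of_pos hr.1]
        exact mul_lt_one_of_nonneg_of_lt_one_left hr.1.le hr.2 (h1 i j)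
    · refine HasDerivAt.hasDerivWithinAt (HasDerivAt.fun_sum fun i _ => HasDerivAt.fun_sum
        fun j _ => HasDerivAt.const_mul _ ?_)
      have hl := abs_lt.1 (hlt i j)
      have hd : HasDerivAt (fun r => r * A i j) (A i j) r := by
        simpa using (hasDerivAt_id r).mul_const (A i j)
      exact (Real.hasDerivAt_arcsin hl.1.ne' hl.2.ne).comp r hd
    · exact (posSemidef_iff_sum_nonneg.1
        (((hA.of_const_mul hr.1.le).of_one_div_sqrt_one_sub_sq hlt).of_mul hA)).2 c
  simpa using hm ⟨le_rfl, zero_le_one⟩ ⟨zero_le_one, le_rfl⟩ zero_le_one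

end Matrix

/-! ### Mixed partial derivatives and additively separated functions -/

theorem ContDiffOn.iteratedDeriv_of_isOpen {f : ℝ → ℝ} {s : Set ℝ} (hf : ContDiffOn ℝ ∞ f s)
    (hs : IsOpen s) (k : ℕ) : ContDiffOn ℝ ∞ (iteratedDeriv k f) s := by
  induction k with
  | zero => simpa using hf
  | succ k ih =>
    rw [iteratedDeriv_succ]
    exact ih.deriv_of_isOpen hs (by simp)

theorem ContDiffOn.hasDerivAt_iteratedDeriv {f : ℝ → ℝ} {s : Set ℝ} (hf : ContDiffOn ℝ ∞ f s)
    (hs : IsOpen s) (k : ℕ) {x : ℝ} (hx : x ∈ s) :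
    HasDerivAt (iteratedDeriv k f) (iteratedDeriv (k + 1) f x) x := by
  rw [iteratedDeriv_succ]
  exact (((hf.iteratedDeriv_of_isOpen hs k).differentiableOn (by simp)).differentiableAt
    (hs.mem_nhds hx)).hasDerivAt

/-- Joint smoothness is what allows differentiating in `u` after differentiating in `v`. -/
theorem ContDiffOn.iteratedDeriv_snd {g : ℝ × ℝ → ℝ} {s : Set (ℝ × ℝ)} (hg : ContDiffOn ℝ ∞ g s)
    (hs : IsOpen s) (j : ℕ) :
    ContDiffOn ℝ ∞ (fun q : ℝ × ℝ => iteratedDeriv j (fun v => g (q.1, v)) q.2) s := by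
  induction j with
  | zero => simpa using hg
  | succ j ih =>
    have h1 : ContDiffOn ℝ ∞ (fun q => fderiv ℝ
        (fun q : ℝ × ℝ => iteratedDeriv j (fun v => g (q.1, v)) q.2) q (0, 1)) s :=
      (ih.fderiv_of_isOpen hs (by simp)).clm_apply contDiffOn_const
    refine h1.congr fun q hq => ?_
    have hd := ((ih.differentiableOn (by simp)).differentiableAt (hs.mem_nhds hq)).hasFDerivAt
    have hl : HasDerivAt (fun v : ℝ => (q.1, v)) ((0 : ℝ), (1 : ℝ)) q.2 :=
      (hasDerivAt_const q.2 q.1).prodMk (hasDerivAt_id q.2)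
    rw [iteratedDeriv_succ]
    exact (hd.comp_hasDerivAt q.2 hl).deriv

/-- The mixed partial derivative of order `(i, j)` times `(-1) ^ (i + j)`. -/
noncomputable def signedPartial (g : ℝ × ℝ → ℝ) (i j : ℕ) (u v : ℝ) : ℝ :=
  (-1) ^ (i + j) * mixedPartial i j g u v

theorem signedPartial_zero_zero (g : ℝ × ℝ → ℝ) (u v : ℝ) : signedPartial g 0 0 u v = g (u, v) := by
  simp [signedPartial, mixedPartial]

namespace IsCompletelyMonotonic

variable {g : ℝ × ℝ → ℝ}

theorem isCMSeq_fst (hg : IsCompletelyMonotonic g) (j : ℕ) {v : ℝ} (hv : 0 < v) :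
    IsCMSeq fun i u => signedPartial g i j u v := by
  intro i u hu
  refine ⟨hg.sign i j u v hu hv, ?_⟩
  have hs : ContDiffOn ℝ ∞ (fun u => iteratedDeriv j (fun v' => g (u, v')) v) (Set.Ioi 0) :=
    (hg.contDiffOn.iteratedDeriv_snd (isOpen_Ioi.prod isOpen_Ioi) j).comp
      (f := fun u : ℝ => (u, v)) (by fun_prop) fun u hu => ⟨hu, hv⟩
  refine ((hs.hasDerivAt_iteratedDeriv isOpen_Ioi i hu).const_mul ((-1) ^ (i + j))).congr_deriv ?_
  simp only [signedPartial, mixedPartial]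
  ring

theorem isCMSeq_snd (hg : IsCompletelyMonotonic g) {u : ℝ} (hu : 0 < u) :
    IsCMSeq fun j v => signedPartial g 0 j u v := by
  intro j v hv
  refine ⟨hg.sign 0 j u v hu hv, ?_⟩
  have hs : ContDiffOn ℝ ∞ (fun v => g (u, v)) (Set.Ioi 0) :=
    hg.contDiffOn.comp (f := fun v : ℝ => (u, v)) (by fun_prop) fun v hv => ⟨hu, hv⟩
  have := (hs.hasDerivAt_iteratedDeriv isOpen_Ioi j hv).const_mul ((-1) ^ (0 + j))
  simp only [signedPartial, mixedPartial, iteratedDeriv_zero]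
  refine this.congr_deriv ?_
  ring

/-- One-variable rigidity is used twice: in `u` for the `(n + 1)`-st `v`-derivative at `v = c`, then
in `v` for `g (u, ·) - g (u', ·)`, which is completely monotonic when `u ≤ u'`. -/
theorem sub_eq_sub (hg : IsCompletelyMonotonic g) {m n : ℕ} {c : ℝ} (hc : 0 < c)
    (h0 : signedPartial g (m + 1) (n + 1) c c = 0) {u u' v v' : ℝ} (hu : 0 < u) (hu' : 0 < u')
    (hv : 0 < v) (hv' : 0 < v') : g (u, v) - g (u', v) = g (u, v') - g (u', v') := by
  wlog hle : u ≤ u' generalizing u u'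
  · have := this hu' hu (le_of_not_ge hle)
    linarith
  have hd : IsCMSeq fun j v => signedPartial g 0 j u v - signedPartial g 0 j u' v := by
    intro j v hv
    refine ⟨sub_nonneg.2 ((hg.isCMSeq_fst j hv).antitoneOn 0 hu hu' hle), ?_⟩
    refine ((hg.isCMSeq_snd hu j v hv).2.sub (hg.isCMSeq_snd hu' j v hv).2).congr_deriv ?_
    ring
  have h1 := (hg.isCMSeq_fst (n + 1) hc).apply_eq hc h0 hu hu'
  simpa only [signedPartial_zero_zero] using hd.apply_eq hc (sub_eq_zero.2 h1) hv hv'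

theorem exists_add_of_signedPartial_eq_zero (hg : IsCompletelyMonotonic g) {m n : ℕ} {c : ℝ}
    (hc : 0 < c) (h0 : signedPartial g (m + 1) (n + 1) c c = 0) :
    ∃ a b : ℝ → ℝ, ∀ u v : ℝ, 0 ≤ u → 0 ≤ v → g (u, v) = a u + b v := by
  refine ⟨fun u => g (u, 1), fun v => g (1, v) - g (1, 1), fun u v hu hv => ?_⟩
  -- The identity holds on the open quadrant; shifting by `e > 0` and letting `e → 0` extends it to
  -- the axes.
  have ht : ∀ f : ℝ → ℝ × ℝ, Continuous f → (∀ e, 0 < e → f e ∈ Set.Ici 0 ×ˢ Set.Ici 0) →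
      f 0 ∈ Set.Ici 0 ×ˢ Set.Ici 0 → Tendsto (fun e => g (f e)) (𝓝[>] 0) (𝓝 (g (f 0))) := by
    intro f hf hfm hf0
    refine (hg.continuousOn _ hf0).tendsto.comp (tendsto_nhdsWithin_iff.2 ⟨?_, ?_⟩)
    · exact (hf.tendsto 0).mono_left nhdsWithin_le_nhds
    · filter_upwards [self_mem_nhdsWithin] with e he using hfm e he
  have t1 := ht (fun e => (u + e, v + e)) (by fun_prop)
    (fun e he => ⟨add_nonneg hu he.le, add_nonneg hv he.le⟩) (by simp [hu, hv])
  have t2 := ht (fun e => (u + e, 1)) (by fun_prop)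
    (fun e he => ⟨add_nonneg hu he.le, zero_le_one (α := ℝ)⟩) (by simp [hu])
  have t3 := ht (fun e => (1, v + e)) (by fun_prop)
    (fun e he => ⟨zero_le_one (α := ℝ), add_nonneg hv he.le⟩) (by simp [hv])
  simp only [add_zero] at t1 t2 t3
  refine tendsto_nhds_unique t1 ((t2.add (t3.sub_const _)).congr' ?_)
  filter_upwards [self_mem_nhdsWithin] with e he
  have := hg.sub_eq_sub hc h0 (u := u + e) (u' := 1) (v := v + e) (v' := 1)
    (add_pos_of_nonneg_of_pos hu he) one_pos (add_pos_of_nonneg_of_pos hv he) one_pos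
  linarith

end IsCompletelyMonotonic

/-! ### Positivity of `g (c - A, c - B)` and of its Taylor remainders -/

open Matrix

variable {ι : Type*} [Finite ι] {A B : Matrix ι ι ℝ} {c : ℝ}

theorem IsCMSeq.posSemidef_taylorTerm {h : ℕ → ℝ → ℝ} (hh : IsCMSeq h) (hA : A.PosSemidef)
    (hc : 0 < c) (k : ℕ) : (of fun i j => h k c / (k.factorial : ℝ) * A i j ^ k).PosSemidef :=
  (hA.of_pow k).of_const_mul (div_nonneg (hh k c hc).1 (Nat.cast_nonneg _))

theorem IsCMSeq.posSemidef {h : ℕ → ℝ → ℝ} (hh : IsCMSeq h) (hA : A.PosSemidef) (hc : 0 < c)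
    (hAc : ∀ i j, |A i j| < c) : (of fun i j => h 0 (c - A i j)).PosSemidef := by
  cases nonempty_fintype ι
  exact posSemidef_of_hasSum (hh.posSemidef_taylorTerm hA hc) fun i j => hh.hasSum (hAc i j)

theorem IsCMSeq.posSemidef_sub {h : ℕ → ℝ → ℝ} (hh : IsCMSeq h) (hA : A.PosSemidef) (hc : 0 < c)
    (hAc : ∀ i j, |A i j| < c) (k : ℕ) :
    ((of fun i j => h 0 (c - A i j)) -
      of fun i j => h k c / (k.factorial : ℝ) * A i j ^ k).PosSemidef := by
  cases nonempty_fintype ι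
  exact posSemidef_sub_of_hasSum (hh.posSemidef_taylorTerm hA hc) (fun i j => hh.hasSum (hAc i j)) k

namespace IsCompletelyMonotonic

variable {g : ℝ × ℝ → ℝ}

/-- No double series is needed: `h1` removes the whole `n`-th term of the expansion in `B`, and `h2`
restores it without its `m`-th term in `A`. -/
theorem posSemidef_sub_of_lt (hg : IsCompletelyMonotonic g) (hA : A.PosSemidef)
    (hB : B.PosSemidef) (hc : 0 < c) (hAc : ∀ i j, |A i j| < c) (hBc : ∀ i j, |B i j| < c)
    (m n : ℕ) :
    (of fun i j => g (c - A i j, c - B i j) -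
      signedPartial g m n c c / (m.factorial * n.factorial : ℝ) *
        (A i j ^ m * B i j ^ n)).PosSemidef := by
  cases nonempty_fintype ι
  have hpow : ∀ k : ℕ, (of fun i j => (k.factorial : ℝ)⁻¹ * B i j ^ k).PosSemidef := fun k =>
    (hB.of_pow k).of_const_mul (by positivity)
  have h1 := posSemidef_sub_of_hasSum (M := of fun i j => g (c - A i j, c - B i j))
    (fun k => ((hg.isCMSeq_fst k hc).posSemidef hA hc hAc).of_mul (hpow k)) (fun i j => by
      have hpos : 0 < c - A i j := sub_pos.2 ((le_abs_self _).trans_lt (hAc i j))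
      have := (hg.isCMSeq_snd hpos).hasSum (hBc i j)
      simpa only [of_apply, signedPartial_zero_zero, div_eq_mul_inv, mul_assoc] using this) n
  have h2 := ((hg.isCMSeq_fst n hc).posSemidef_sub hA hc hAc m).of_mul (hpow n)
  convert h1.add h2 using 1
  ext i j
  simp only [of_apply, Matrix.add_apply, Matrix.sub_apply]
  field_simp
  ring

theorem posSemidef_sub (hg : IsCompletelyMonotonic g) (hA : A.PosSemidef)
    (hB : B.PosSemidef) (hc : 0 < c) (hAc : ∀ i j, |A i j| ≤ c) (hBc : ∀ i j, |B i j| ≤ c)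
    (m n : ℕ) :
    (of fun i j => g (c - A i j, c - B i j) -
      signedPartial g m n c c / (m.factorial * n.factorial : ℝ) *
        (A i j ^ m * B i j ^ n)).PosSemidef := by
  cases nonempty_fintype ι
  have hlt : ∀ r ∈ Set.Ioo (0 : ℝ) 1, ∀ t, |t| ≤ c → |r * t| < c := fun r hr t ht => by
    rw [abs_mul, abs_of_pos hr.1]
    nlinarith [hr.1, hr.2]
  have hmem : Set.Ioo (0 : ℝ) 1 ∈ 𝓝[<] (1 : ℝ) := Ioo_mem_nhdsLT one_pos
  refine posSemidef_of_tendsto (l := 𝓝[<] (1 : ℝ)) (F := fun r =>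
    of fun i j => g (c - r * A i j, c - r * B i j) -
      signedPartial g m n c c / (m.factorial * n.factorial : ℝ) *
        ((r * A i j) ^ m * (r * B i j) ^ n)) ?_ (fun i j => ?_)
  · filter_upwards [hmem] with r hr
    exact hg.posSemidef_sub_of_lt (hA.of_const_mul hr.1.le) (hB.of_const_mul hr.1.le) hc
      (fun i j => hlt r hr _ (hAc i j)) (fun i j => hlt r hr _ (hBc i j)) m n
  · refine Tendsto.sub ?_ ?_
    · have hin : (c - A i j, c - B i j) ∈ Set.Ici (0 : ℝ) ×ˢ Set.Ici (0 : ℝ) :=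
        ⟨sub_nonneg.2 ((le_abs_self _).trans (hAc i j)),
          sub_nonneg.2 ((le_abs_self _).trans (hBc i j))⟩
      refine (hg.continuousOn _ hin).tendsto.comp (tendsto_nhdsWithin_iff.2 ⟨?_, ?_⟩)
      · have : Continuous fun r : ℝ => (c - r * A i j, c - r * B i j) := by fun_prop
        simpa using (this.tendsto 1).mono_left nhdsWithin_le_nhds
      · filter_upwards [hmem] with r hr
        exact ⟨sub_nonneg.2 ((le_abs_self _).trans (hlt r hr _ (hAc i j)).le),
          sub_nonneg.2 ((le_abs_self _).trans (hlt r hr _ (hBc i j)).le)⟩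
    · have : Continuous fun r : ℝ => signedPartial g m n c c / (m.factorial * n.factorial : ℝ) *
        ((r * A i j) ^ m * (r * B i j) ^ n) := by fun_prop
      simpa using (this.tendsto 1).mono_left nhdsWithin_le_nhds

theorem posSemidef (hg : IsCompletelyMonotonic g) (hA : A.PosSemidef)
    (hB : B.PosSemidef) (hc : 0 < c) (hAc : ∀ i j, |A i j| ≤ c) (hBc : ∀ i j, |B i j| ≤ c) :
    (of fun i j => g (c - A i j, c - B i j)).PosSemidef := by
  have h0 : 0 ≤ signedPartial g 0 0 c c / (Nat.factorial 0 * Nat.factorial 0 : ℝ) :=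
    div_nonneg (hg.sign 0 0 c c hc hc) (by positivity)
  convert (hg.posSemidef_sub hA hB hc hAc hBc 0 0).add
    (((hA.of_pow 0).of_mul (hB.of_pow 0)).of_const_mul h0) using 1
  ext i j
  simp

end IsCompletelyMonotonic

/-! ### Separating the diagonal by high powers -/

/-- Adding consecutive powers cancels the oscillation at `t = -1`, which corresponds to antipodal
points. -/
theorem tendsto_pow_add_pow_of_abs_le_one {t : ℝ} (ht : |t| ≤ 1) :
    Tendsto (fun k : ℕ => t ^ (2 * k + 2) + t ^ (2 * k + 3)) atTop
      (𝓝 (if t = 1 then 2 else 0)) := by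
  rcases ht.lt_or_eq with hlt | heq
  · have h1 : t ≠ 1 := by rintro rfl; simp at hlt
    have h := tendsto_pow_atTop_nhds_zero_of_abs_lt_one hlt
    have h2 : Tendsto (fun k : ℕ => 2 * k + 2) atTop atTop :=
      tendsto_atTop_mono (fun k => by simp only [id]; omega) tendsto_id
    have h3 : Tendsto (fun k : ℕ => 2 * k + 3) atTop atTop :=
      tendsto_atTop_mono (fun k => by simp only [id]; omega) tendsto_id
    simpa [h1] using (h.comp h2).add (h.comp h3)
  · rcases eq_or_eq_neg_of_abs_eq heq with rfl | rfl
    · norm_num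
    · have : (-1 : ℝ) ≠ 1 := by norm_num
      norm_num [this, pow_add, pow_mul]

/-- The powers `A ^ m ∘ B ^ n` with `m, n ≥ 1` separate the diagonal. -/
theorem eq_zero_of_sum_pow_eq_zero {ι : Type*} [Fintype ι] [DecidableEq ι] {A B : Matrix ι ι ℝ}
    {c : ℝ} (hc : 0 < c) (hAc : ∀ i j, |A i j| ≤ c) (hBc : ∀ i j, |B i j| ≤ c)
    (hAB : ∀ i j, A i j = c ∧ B i j = c ↔ i = j) {w : ι → ℝ}
    (hw : ∀ m n : ℕ, ∑ i, ∑ j, w i * w j * (A i j ^ (m + 1) * B i j ^ (n + 1)) = 0) : w = 0 := by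
  have habs : ∀ t, |t| ≤ c → |t / c| ≤ 1 := fun t ht => by
    rwa [abs_div, abs_of_pos hc, div_le_one hc]
  have hlim := tendsto_finsetSum univ fun i _ => tendsto_finsetSum univ fun j _ =>
    ((tendsto_pow_add_pow_of_abs_le_one (habs _ (hAc i j))).mul
      (tendsto_pow_add_pow_of_abs_le_one (habs _ (hBc i j)))).const_mul (w i * w j)
  have hzero : ∀ k : ℕ, ∑ i, ∑ j, w i * w j *
      (((A i j / c) ^ (2 * k + 2) + (A i j / c) ^ (2 * k + 3)) *
        ((B i j / c) ^ (2 * k + 2) + (B i j / c) ^ (2 * k + 3))) = 0 := by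
    intro k
    have hs : ∀ m n : ℕ,
        ∑ i, ∑ j, w i * w j * ((A i j / c) ^ (m + 1) * (B i j / c) ^ (n + 1)) = 0 := by
      intro m n
      have := congrArg (fun x => (c ^ (m + 1) * c ^ (n + 1))⁻¹ * x) (hw m n)
      simp only [mul_sum, mul_zero] at this
      rw [← this]
      refine sum_congr rfl fun i _ => sum_congr rfl fun j _ => ?_
      rw [div_pow, div_pow, mul_inv]
      ring
    have e1 := hs (2 * k + 1) (2 * k + 1)
    have e2 := hs (2 * k + 1) (2 * k + 2)
    have e3 := hs (2 * k + 2) (2 * k + 1)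
    have e4 := hs (2 * k + 2) (2 * k + 2)
    simp only [add_mul, mul_add, sum_add_distrib]
    linarith
  have hval := tendsto_nhds_unique hlim (by simpa only [hzero] using tendsto_const_nhds)
  -- The limit weight is `2 * 2` where both entries equal `c`, that is on the diagonal, and `0`
  -- elsewhere.
  have hterm : ∀ i j, w i * w j * ((if A i j / c = 1 then (2 : ℝ) else 0) *
      (if B i j / c = 1 then (2 : ℝ) else 0)) = if i = j then 4 * (w i) ^ 2 else 0 := by
    intro i j
    simp only [div_eq_one_iff_eq hc.ne']
    by_cases hij : i = j
    · obtain ⟨h1, h2⟩ := (hAB i j).2 hij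
      subst hij
      simp only [h1, h2, if_true]
      ring
    · have := mt (hAB i j).1 hij
      rw [if_neg hij]
      by_cases h1 : A i j = c
      · have h2 : B i j ≠ c := fun h2 => this ⟨h1, h2⟩
        simp [h2]
      · simp [h1]
  simp only [hterm, sum_ite_eq, mem_univ, if_true] at hval
  rw [sum_eq_zero_iff_of_nonneg (fun i _ => by positivity)] at hval
  funext i
  simpa using hval i (mem_univ i)

/-! ### Arcsine Gram matrices on spheres and the conclusion -/

section Sphere

variable {E : Type*} [NormedAddCommGroup E] [InnerProductSpace ℝ E]

theorem abs_inner_le_one_of_sphere (x y : Metric.sphere (0 : E) 1) :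
    |inner ℝ (x : E) (y : E)| ≤ 1 := by
  simpa using abs_real_inner_le_norm (x : E) (y : E)

theorem abs_arcsin_le (t : ℝ) : |Real.arcsin t| ≤ Real.pi / 2 :=
  abs_le.2 ⟨Real.neg_pi_div_two_le_arcsin t, Real.arcsin_le_pi_div_two t⟩

theorem posSemidef_arcsin_inner {ι : Type*} [Finite ι] (x : ι → Metric.sphere (0 : E) 1) :
    (of fun i j => Real.arcsin (inner ℝ (x i : E) (x j : E))).PosSemidef :=
  (posSemidef_gram ℝ fun i => (x i : E)).of_arcsin fun i j => abs_inner_le_one_of_sphere (x i) (x j)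

theorem arcsin_inner_eq_pi_div_two_iff (x y : Metric.sphere (0 : E) 1) :
    Real.arcsin (inner ℝ (x : E) (y : E)) = Real.pi / 2 ↔ x = y := by
  rw [Real.arcsin_eq_pi_div_two, Subtype.ext_iff,
    ← inner_eq_one_iff_of_norm_eq_one (𝕜 := ℝ) (norm_eq_of_mem_sphere x) (norm_eq_of_mem_sphere y)]
  exact ⟨fun h => le_antisymm ((le_abs_self _).trans (abs_inner_le_one_of_sphere x y)) h,
    fun h => h.ge⟩

end Sphere

theorem mainTheorem4 (m M : ℕ∞) (hm : 1 ≤ m) (hM : 1 ≤ M)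
    (g : ℝ × ℝ → ℝ) (hg : IsCompletelyMonotonic g) :
    IsPartOfPosDef m M (fun t s => g (Real.arccos t, Real.arccos s)) ∧
    ((¬ ∃ a b : ℝ → ℝ, ∀ u v : ℝ, 0 ≤ u → 0 ≤ v → g (u, v) = a u + b v) →
      IsPartOfStrictlyPosDef m M (fun t s => g (Real.arccos t, Real.arccos s))) := by
  set K : USphere m × USphere M → USphere m × USphere M → ℝ := fun p q =>
    g (Real.arccos (inner ℝ (p.1 : Ambient m) (q.1 : Ambient m)),
      Real.arccos (inner ℝ (p.2 : Ambient M) (q.2 : Ambient M))) with hK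
  have hiso : IsIsotropicPart (fun t s => g (Real.arccos t, Real.arccos s)) K :=
    fun x y z w => rfl
  have hcont : Continuous (Function.uncurry K) := by
    refine hg.continuousOn.comp_continuous (f := fun pq : (USphere m × USphere M) ×
      (USphere m × USphere M) => (Real.arccos (inner ℝ (pq.1.1 : Ambient m) (pq.2.1 : Ambient m)),
      Real.arccos (inner ℝ (pq.1.2 : Ambient M) (pq.2.2 : Ambient M)))) ?_ fun pq =>
        ⟨Real.arccos_nonneg _, Real.arccos_nonneg _⟩
    refine .prodMk (Real.continuous_arccos.comp (.inner ?_ ?_))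
      (Real.continuous_arccos.comp (.inner ?_ ?_)) <;> fun_prop
  have hc : 0 < Real.pi / 2 := by positivity
  have hpd : IsPosDefKernel K := by
    intro n _ x _ c
    have := hg.posSemidef (posSemidef_arcsin_inner fun i => (x i).1)
      (posSemidef_arcsin_inner fun i => (x i).2) hc (fun i j => abs_arcsin_le _)
      (fun i j => abs_arcsin_le _)
    simpa only [of_apply, ← Real.arccos_eq_pi_div_two_sub_arcsin] using
      (posSemidef_iff_sum_nonneg.1 this).2 c
  refine ⟨⟨K, hiso, hcont, hpd⟩, fun hna => 
    ⟨K, hiso, hcont, fun n hn => ⟨hpd, fun x hx w hw => ?_⟩⟩⟩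
  refine (hpd n hn x hx w).lt_of_ne fun hzero => hw ?_
  set A : Matrix (Fin n) (Fin n) ℝ :=
    of fun i j => Real.arcsin (inner ℝ ((x i).1 : Ambient m) ((x j).1 : Ambient m)) with hA
  set B : Matrix (Fin n) (Fin n) ℝ :=
    of fun i j => Real.arcsin (inner ℝ ((x i).2 : Ambient M) ((x j).2 : Ambient M)) with hB
  have hApsd : A.PosSemidef := posSemidef_arcsin_inner fun i => (x i).1
  have hBpsd : B.PosSemidef := posSemidef_arcsin_inner fun i => (x i).2
  have hAc : ∀ i j, |A i j| ≤ Real.pi / 2 := fun i j => abs_arcsin_le _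
  have hBc : ∀ i j, |B i j| ≤ Real.pi / 2 := fun i j => abs_arcsin_le _
  refine eq_zero_of_sum_pow_eq_zero hc hAc hBc (fun i j => ?_) (fun k l => ?_)
  · rw [hA, hB, of_apply, of_apply, arcsin_inner_eq_pi_div_two_iff, arcsin_inner_eq_pi_div_two_iff,
      ← Prod.ext_iff, hx.eq_iff]
  have hpos : 0 < signedPartial g (k + 1) (l + 1) (Real.pi / 2) (Real.pi / 2) /
      ((k + 1).factorial * (l + 1).factorial : ℝ) := by
    refine div_pos ((hg.sign _ _ _ _ hc hc).lt_of_ne fun h => hna ?_) (by positivity)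
    exact hg.exists_add_of_signedPartial_eq_zero hc h.symm
  -- As the form of `g` vanishes at `w`, this says that minus a positive multiple of the form in
  -- `hterm` is nonnegative; hence that form is zero.
  have hsub := (posSemidef_iff_sum_nonneg.1
    (hg.posSemidef_sub hApsd hBpsd hc hAc hBc (k + 1) (l + 1))).2 w
  have hterm := (posSemidef_iff_sum_nonneg.1
    ((hApsd.of_pow (k + 1)).of_mul (hBpsd.of_pow (l + 1)))).2 w
  simp only [of_apply] at hterm
  have hzero' : ∑ i, ∑ j, w i * w j * g (Real.pi / 2 - A i j, Real.pi / 2 - B i j) = 0 := by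
    rw [hzero]
    simp only [hA, hB, of_apply, ← Real.arccos_eq_pi_div_two_sub_arcsin, hK]
  simp only [of_apply, mul_sub, sum_sub_distrib, hzero', zero_sub, Left.nonneg_neg_iff,
    mul_left_comm (w _ * w _) (_ / _), ← mul_sum] at hsub
  exact le_antisymm (nonpos_of_mul_nonpos_right hsub hpos) hterm
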